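/- Let $n$ be a nonnegative integer and let $A$ be an $n\times n$ complex matrix. Write $A^*$ for the conjugate transpose, $\sigma(A)$ for the set of eigenvalues of $A$, $\mathbb{D}=\{z\in\mathbb{C}:|z|<1\}$ and $\mathbb{T}=\{z\in\mathbb{C}:|z|=1\}$. A matrix $V$ is a partial isometry if $VV^*V=V$. Then $A$ is similar to a partial isometry (that is, $A=SVS^{-1}$ for some invertible $n\times n$ complex matrix $S$ and some $n\times n$ partial isometry $V$) if and only if the following three conditions all hold: (a) $\sigma(A)\subseteq\{z\in\mathbb{C}:|z|\le 1\}$; (b) for every $\zeta\in\sigma(A)\cap\mathbb{T}$, the algebraic multiplicity of $\zeta$ (its multiplicity as a root of the characteristic polynomial $\det(zI-A)$) equals its geometric multiplicity $\dim\ker(A-\zeta I)$; (c) $\dim\ker A\ge\dim\ker(A-\lambda I)$ for every $\lambda\in\sigma(A)\cap\mathbb{D}$. -/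

import Mathlib

/-- A square complex matrix `A` is a partial isometry (partially isometric matrix) if
`A A* A = A`, where `A*` is the conjugate transpose. -/
def IsPartialIsometry {n : ℕ} (A : Matrix (Fin n) (Fin n) ℂ) : Prop :=
  A * A.conjTranspose * A = A

/-- Similarity of complex square matrices: `A = S B S⁻¹` for some invertible matrix `S`. -/
def IsSimilar {n : ℕ} (A B : Matrix (Fin n) (Fin n) ℂ) : Prop :=
  ∃ S : Matrix (Fin n) (Fin n) ℂ, IsUnit S ∧ A = S * B * S⁻¹

/-- The nullity `dim ker A`. -/
noncomputable def nullity {n : ℕ} (A : Matrix (Fin n) (Fin n) ℂ) : ℕ :=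
  Module.finrank ℂ (LinearMap.ker A.mulVecLin)

/-- The geometric multiplicity of `μ` for `A`, i.e. `dim ker (A - μ I)`. -/
noncomputable def geometricMultiplicity {n : ℕ} (A : Matrix (Fin n) (Fin n) ℂ) (μ : ℂ) : ℕ :=
  nullity (A - μ • (1 : Matrix (Fin n) (Fin n) ℂ))

/-- The algebraic multiplicity of `μ` for `A`: its multiplicity as a root of the
characteristic polynomial of `A`. -/
noncomputable def algebraicMultiplicity {n : ℕ} (A : Matrix (Fin n) (Fin n) ℂ) (μ : ℂ) : ℕ :=
  A.charpoly.rootMultiplicity μ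

open Matrix
open scoped ComplexOrder MatrixOrder

/-! Necessity rests on `‖Vx‖² + ‖x - V*Vx‖² = ‖x‖²`. It bounds the eigenvalues by 1, makes a
unimodular eigenvector of `V` an eigenvector of `V*` as well (so no Jordan chain starts there), and
shows that no eigenvector with `|μ| < 1` lies in the range of `V*`, whose codimension is `dim ker
V`.

Sufficiency is a change of inner product: it is enough to find a positive definite `G` with `G -
A*GA = Q*Q` and `rank Q ≤ dim ker A` (`exists_isPartialIsometry_isSimilar_of_posDef`). Such a `G` is
a sum of two pieces. The spectral projections `E ζ` at unimodular eigenvalues give the `A`-invariant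
form `∑ (E ζ)* E ζ`. On the complementary projection `P` the powers of `A` are summable, and `∑
(CPAᵏ)* (CPAᵏ)` has defect `(CP)*(CP)`. By (c), a `C` of rank at most `dim ker A` in general
position is injective on every eigenspace inside the disc. This makes the total definite: its kernel
is `A`-invariant, so if nonzero it would contain an eigenvector of `A`. -/

/-! ### Eigenvalues, nullity and multiplicities. -/

theorem mem_spectrum_iff_exists_mulVec {n : ℕ} {A : Matrix (Fin n) (Fin n) ℂ} {μ : ℂ} :
    μ ∈ spectrum ℂ A ↔ ∃ x, x ≠ 0 ∧ A *ᵥ x = μ • x := by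
  rw [spectrum.mem_iff, Matrix.isUnit_iff_isUnit_det, isUnit_iff_ne_zero, not_not,
    ← Matrix.exists_mulVec_eq_zero_iff]
  simp only [Matrix.sub_mulVec, Algebra.algebraMap_eq_smul_one, Matrix.smul_mulVec,
    Matrix.one_mulVec, sub_eq_zero, eq_comm]

theorem mem_ker_sub_smul_one {n : ℕ} {A : Matrix (Fin n) (Fin n) ℂ} {μ : ℂ} {x : Fin n → ℂ} :
    x ∈ LinearMap.ker (A - μ • (1 : Matrix (Fin n) (Fin n) ℂ)).mulVecLin ↔ A *ᵥ x = μ • x := by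
  rw [LinearMap.mem_ker, mulVecLin_apply, sub_mulVec, smul_mulVec, one_mulVec, sub_eq_zero]

theorem nullity_add_rank {n : ℕ} (A : Matrix (Fin n) (Fin n) ℂ) : nullity A + A.rank = n := by
  rw [nullity, Matrix.rank, add_comm, LinearMap.finrank_range_add_finrank_ker]
  simp

theorem nullity_conj {n : ℕ} {S : Matrix (Fin n) (Fin n) ℂ} (hS : IsUnit S)
    (V : Matrix (Fin n) (Fin n) ℂ) : nullity (S * V * S⁻¹) = nullity V := by
  have h1 := nullity_add_rank (S * V * S⁻¹)
  have h2 := nullity_add_rank V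
  have hd := (Matrix.isUnit_iff_isUnit_det _).1 hS
  rw [Matrix.rank_mul_eq_left_of_isUnit_det _ _ (Matrix.isUnit_nonsing_inv_det _ hd),
    Matrix.rank_mul_eq_right_of_isUnit_det _ _ hd] at h1
  omega

/-- The algebraic multiplicity is the dimension of the maximal generalized eigenspace, which
contains the eigenspace; equal dimensions mean equal spaces. -/
theorem algebraicMultiplicity_eq_geometricMultiplicity_iff {n : ℕ}
    (A : Matrix (Fin n) (Fin n) ℂ) (μ : ℂ) :
    algebraicMultiplicity A μ = geometricMultiplicity A μ ↔
      ∀ (k : ℕ) (x : Fin n → ℂ), ((A - μ • (1 : Matrix (Fin n) (Fin n) ℂ)) ^ k) *ᵥ x = 0 →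
        A *ᵥ x = μ • x := by
  have h1 : algebraicMultiplicity A μ =
      Module.finrank ℂ (Module.End.maxGenEigenspace (Matrix.toLin' A) μ) := by
    rw [LinearMap.finrank_maxGenEigenspace_eq, Matrix.charpoly_toLin', algebraicMultiplicity]
  have h2 : LinearMap.ker (A - μ • (1 : Matrix (Fin n) (Fin n) ℂ)).mulVecLin =
      Module.End.eigenspace (Matrix.toLin' A) μ := by
    ext x
    rw [mem_ker_sub_smul_one, Module.End.mem_eigenspace_iff, Matrix.toLin'_apply]
  have hle : Module.End.eigenspace (Matrix.toLin' A) μ ≤ Module.End.maxGenEigenspace (Matrix.toLin' A) μ :=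
    Module.End.genEigenspace_le_maximal _ _ _
  have h3 : ∀ x, x ∈ Module.End.maxGenEigenspace (Matrix.toLin' A) μ ↔
      ∃ k : ℕ, ((A - μ • (1 : Matrix (Fin n) (Fin n) ℂ)) ^ k) *ᵥ x = 0 := by
    intro x
    rw [Module.End.mem_maxGenEigenspace]
    have : Matrix.toLin' A - μ • (1 : Module.End ℂ (Fin n → ℂ)) =
        Matrix.toLin' (A - μ • (1 : Matrix (Fin n) (Fin n) ℂ)) := by
      simp [Module.End.one_eq_id]
    simp_rw [this, ← Matrix.toLin'_pow, Matrix.toLin'_apply]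
  rw [h1, geometricMultiplicity, nullity, h2]
  constructor
  · intro h k x hx
    have := Submodule.eq_of_le_of_finrank_eq hle h.symm
    have hx' := (h3 x).2 ⟨k, hx⟩
    rwa [← this, Module.End.mem_eigenspace_iff, Matrix.toLin'_apply] at hx'
  · intro h
    refine congrArg (fun W : Submodule ℂ (Fin n → ℂ) => Module.finrank ℂ W)
      (le_antisymm (fun x hx => ?_) hle)
    obtain ⟨k, hk⟩ := (h3 x).1 hx
    rw [Module.End.mem_eigenspace_iff, Matrix.toLin'_apply]
    exact h k x hk

/-! ### Necessity: spectral properties of partial isometries. -/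

namespace IsPartialIsometry

variable {n : ℕ} {V : Matrix (Fin n) (Fin n) ℂ}

/-- Pythagoras for the orthogonal projection `V*V`. -/
theorem star_mulVec_dotProduct_self (hV : IsPartialIsometry V) (x : Fin n → ℂ) :
    star (V *ᵥ x) ⬝ᵥ (V *ᵥ x) + star (x - Vᴴ *ᵥ (V *ᵥ x)) ⬝ᵥ (x - Vᴴ *ᵥ (V *ᵥ x)) =
      star x ⬝ᵥ x := by
  have key : Vᴴ * V + (1 - Vᴴ * V)ᴴ * (1 - Vᴴ * V) = 1 := by
    have h : Vᴴ * V * (Vᴴ * V) = Vᴴ * V := by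
      rw [Matrix.mul_assoc, ← Matrix.mul_assoc V, show V * Vᴴ * V = V from hV]
    simp only [conjTranspose_sub, conjTranspose_one, conjTranspose_mul,
      conjTranspose_conjTranspose, sub_mul, mul_sub, one_mul, mul_one, h]
    abel
  have h := congrArg (fun M => star x ⬝ᵥ (M *ᵥ x)) key
  simp only [add_mulVec, dotProduct_add, one_mulVec] at h
  rw [← h]
  have e : x - Vᴴ *ᵥ (V *ᵥ x) = (1 - Vᴴ * V) *ᵥ x := by
    rw [sub_mulVec, one_mulVec, mulVec_mulVec]
  rw [e, star_mulVec, star_mulVec, ← dotProduct_mulVec, ← dotProduct_mulVec, mulVec_mulVec,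
    mulVec_mulVec]

theorem norm_sq_mul_add_of_eigenvector (hV : IsPartialIsometry V) {μ : ℂ} {x : Fin n → ℂ}
    (h : V *ᵥ x = μ • x) :
    (‖μ‖ ^ 2 : ℝ) * (star x ⬝ᵥ x) +
      star (x - Vᴴ *ᵥ (V *ᵥ x)) ⬝ᵥ (x - Vᴴ *ᵥ (V *ᵥ x)) = star x ⬝ᵥ x := by
  refine Eq.trans ?_ (hV.star_mulVec_dotProduct_self x)
  congr 1
  rw [h, star_smul, smul_dotProduct, dotProduct_smul, smul_eq_mul, smul_eq_mul, ← mul_assoc,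
    Complex.star_def, Complex.conj_mul', Complex.ofReal_pow]

theorem norm_eigenvalue_le_one (hV : IsPartialIsometry V) {μ : ℂ} {x : Fin n → ℂ} (hx : x ≠ 0)
    (h : V *ᵥ x = μ • x) : ‖μ‖ ≤ 1 := by
  have h1 := congrArg Complex.re (hV.norm_sq_mul_add_of_eigenvector h)
  have h2 : 0 ≤ star (x - Vᴴ *ᵥ (V *ᵥ x)) ⬝ᵥ (x - Vᴴ *ᵥ (V *ᵥ x)) :=
    dotProduct_star_self_nonneg _
  have h3 : 0 < star x ⬝ᵥ x := dotProduct_star_self_pos_iff.2 hx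
  rw [Complex.add_re, Complex.re_ofReal_mul] at h1
  have h2' := (Complex.le_def.1 h2).1
  have h3' := (Complex.lt_def.1 h3).1
  rw [Complex.zero_re] at h2' h3'
  have h4 : ‖μ‖ ^ 2 ≤ 1 := by
    by_contra! hc
    nlinarith
  exact (sq_le_one_iff₀ (norm_nonneg μ)).1 h4

theorem conjTranspose_mulVec_of_unimodular (hV : IsPartialIsometry V) {μ : ℂ} {x : Fin n → ℂ}
    (hμ : ‖μ‖ = 1) (h : V *ᵥ x = μ • x) : Vᴴ *ᵥ x = star μ • x := by
  have h1 := hV.norm_sq_mul_add_of_eigenvector h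
  rw [hμ, one_pow, Complex.ofReal_one, one_mul, add_eq_left, dotProduct_star_self_eq_zero,
    sub_eq_zero, h, mulVec_smul] at h1
  conv_rhs => rw [h1]
  rw [smul_smul, Complex.star_def, Complex.conj_mul', hμ]
  simp

/-- By induction `y = Vx - ζx` satisfies `Vy = ζy`, hence `V*y = ζ̄y`, and then `⟨y, y⟩ = ⟨V*y, x⟩ -
ζ⟨y, x⟩ = 0`, the form being conjugate-linear on the left. -/
theorem mulVec_eq_smul_of_sub_pow_mulVec_eq_zero (hV : IsPartialIsometry V) {ζ : ℂ}
    (hζ : ‖ζ‖ = 1) (k : ℕ) {x : Fin n → ℂ}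
    (hx : ((V - ζ • (1 : Matrix (Fin n) (Fin n) ℂ)) ^ k) *ᵥ x = 0) : V *ᵥ x = ζ • x := by
  induction k generalizing x with
  | zero => simp_all
  | succ k ih =>
    rw [pow_succ, ← mulVec_mulVec] at hx
    have h : (V - ζ • (1 : Matrix (Fin n) (Fin n) ℂ)) *ᵥ x = V *ᵥ x - ζ • x := by
      rw [sub_mulVec, smul_mulVec, one_mulVec]
    have hy := ih hx
    rw [h] at hy
    have h1 := hV.conjTranspose_mulVec_of_unimodular hζ hy
    have h2 : star (V *ᵥ x - ζ • x) ⬝ᵥ (V *ᵥ x - ζ • x) = 0 := by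
      rw [dotProduct_sub, dotProduct_mulVec, ← conjTranspose_conjTranspose V, ← star_mulVec,
        conjTranspose_conjTranspose, h1, star_smul, star_star, smul_dotProduct, dotProduct_smul,
        sub_self]
    rwa [dotProduct_star_self_eq_zero, sub_eq_zero] at h2

/-- `V` is isometric on the range of `V*`, which therefore contains no eigenvector with `|μ| < 1`.
That range has dimension `n - nullity V`. -/
theorem nullity_sub_smul_one_le (hV : IsPartialIsometry V) {μ : ℂ} (hμ : ‖μ‖ < 1) :
    nullity (V - μ • (1 : Matrix (Fin n) (Fin n) ℂ)) ≤ nullity V := by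
  have hd : Disjoint (LinearMap.ker (V - μ • (1 : Matrix (Fin n) (Fin n) ℂ)).mulVecLin)
      (LinearMap.range Vᴴ.mulVecLin) := by
    rw [Submodule.disjoint_def]
    rintro x hx ⟨y, rfl⟩
    rw [mem_ker_sub_smul_one] at hx
    rw [mulVecLin_apply] at hx ⊢
    have h1 := hV.norm_sq_mul_add_of_eigenvector hx
    have hz : Vᴴ *ᵥ (V *ᵥ (Vᴴ *ᵥ y)) = Vᴴ *ᵥ y := by
      have h := congrArg conjTranspose (show V * Vᴴ * V = V from hV)
      simp only [conjTranspose_mul, conjTranspose_conjTranspose] at h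
      rw [mulVec_mulVec, mulVec_mulVec, mul_assoc, h]
    rw [hz, sub_self, star_zero, zero_dotProduct, add_zero] at h1
    have h2 : ((‖μ‖ ^ 2 : ℝ) : ℂ) ≠ 1 := by
      norm_cast
      nlinarith [norm_nonneg μ]
    rw [← sub_eq_zero, ← sub_one_mul] at h1
    exact dotProduct_star_self_eq_zero.1
      ((mul_eq_zero.1 h1).resolve_left (sub_ne_zero.2 h2))
  have h1 := Submodule.finrank_add_finrank_le_of_disjoint hd
  have h2 := nullity_add_rank V
  rw [← rank_conjTranspose] at h2
  rw [Module.finrank_fin_fun] at h1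
  change nullity _ + Vᴴ.rank ≤ n at h1
  omega

end IsPartialIsometry

theorem conj_sub_smul_one {n : ℕ} {S : Matrix (Fin n) (Fin n) ℂ} (hS : IsUnit S)
    (V : Matrix (Fin n) (Fin n) ℂ) (μ : ℂ) :
    S * V * S⁻¹ - μ • (1 : Matrix (Fin n) (Fin n) ℂ) =
      S * (V - μ • (1 : Matrix (Fin n) (Fin n) ℂ)) * S⁻¹ := by
  have hd := (Matrix.isUnit_iff_isUnit_det _).1 hS
  rw [mul_sub, sub_mul, mul_smul_comm, mul_one, smul_mul_assoc, mul_nonsing_inv _ hd]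

theorem conditions_of_isSimilar_isPartialIsometry {n : ℕ} {A V : Matrix (Fin n) (Fin n) ℂ}
    (hV : IsPartialIsometry V) (hAV : IsSimilar A V) :
    (spectrum ℂ A ⊆ Metric.closedBall (0 : ℂ) 1) ∧
      (∀ ζ ∈ spectrum ℂ A ∩ Metric.sphere (0 : ℂ) 1,
        algebraicMultiplicity A ζ = geometricMultiplicity A ζ) ∧
      (∀ μ ∈ spectrum ℂ A ∩ Metric.ball (0 : ℂ) 1,
        nullity A ≥ nullity (A - μ • (1 : Matrix (Fin n) (Fin n) ℂ))) := by
  obtain ⟨S, hS, rfl⟩ := hAV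
  refine ⟨?_, ?_, ?_⟩
  · obtain ⟨u, rfl⟩ := hS
    rw [← coe_units_inv, spectrum.units_conjugate]
    intro μ hμ
    obtain ⟨x, hx, h⟩ := mem_spectrum_iff_exists_mulVec.1 hμ
    simpa using hV.norm_eigenvalue_le_one hx h
  · rintro ζ ⟨-, hζ⟩
    rw [mem_sphere_zero_iff_norm] at hζ
    rw [geometricMultiplicity, conj_sub_smul_one hS, nullity_conj hS, algebraicMultiplicity]
    obtain ⟨u, rfl⟩ := hS
    rw [charpoly_units_conj]
    exact (algebraicMultiplicity_eq_geometricMultiplicity_iff V ζ).2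
      fun k x hx => hV.mulVec_eq_smul_of_sub_pow_mulVec_eq_zero hζ k hx
  · rintro μ ⟨-, hμ⟩
    rw [conj_sub_smul_one hS, nullity_conj hS, nullity_conj hS]
    exact hV.nullity_sub_smul_one_le (mem_ball_zero_iff.1 hμ)

/-! ### Subspaces in general position. -/

theorem exists_submodule_finrank_eq_forall_disjoint {K E : Type*} [Field K] [Infinite K]
    [AddCommGroup E] [Module K E] [FiniteDimensional K E] (s : Finset (Submodule K E)) {k : ℕ}
    (hs : ∀ W ∈ s, Module.finrank K W ≤ k) (m : ℕ) (hm : m + k ≤ Module.finrank K E) :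
    ∃ U : Submodule K E, Module.finrank K U = m ∧ ∀ W ∈ s, Disjoint U W := by
  classical
  induction m with
  | zero => exact ⟨⊥, finrank_bot K E, fun W _ => disjoint_bot_left⟩
  | succ m ih =>
    obtain ⟨U, hU, hd⟩ := ih (by omega)
    -- Over an infinite field finitely many proper subspaces do not cover `E`. Avoiding `U` makes
    -- the dimension grow; avoiding each `U ⊔ W` keeps disjointness from `W`.
    have htop : ⊤ ∉ insert U (s.image fun W => U ⊔ W) := by
      intro h
      rcases Finset.mem_insert.1 h with h | h
      · rw [← h, finrank_top] at hU
        omega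
      · obtain ⟨W, hW, h⟩ := Finset.mem_image.1 h
        have h1 := Submodule.finrank_add_le_finrank_add_finrank U W
        rw [h, finrank_top] at h1
        have := hs W hW
        omega
    obtain ⟨x, hx⟩ := (Set.ne_univ_iff_exists_notMem _).1
      (Subspace.biUnion_ne_univ_of_top_notMem htop)
    simp only [Finset.mem_insert, Finset.mem_image, Set.mem_iUnion, not_exists,
      SetLike.mem_coe] at hx
    have hxU : x ∉ U := hx U (Or.inl rfl)
    have hx0 : x ≠ 0 := fun h => hxU (h ▸ U.zero_mem)
    refine ⟨U ⊔ K ∙ x, ?_, fun W hW => ?_⟩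
    · have h1 := Submodule.finrank_sup_add_finrank_inf_eq U (K ∙ x)
      rw [((Submodule.disjoint_span_singleton' hx0).2 hxU).eq_bot, finrank_bot,
        finrank_span_singleton hx0] at h1
      omega
    · have h1 : Disjoint (U ⊔ W) (K ∙ x) :=
        (Submodule.disjoint_span_singleton' hx0).2 (hx (U ⊔ W) (Or.inr ⟨W, hW, rfl⟩))
      rw [sup_comm] at h1 ⊢
      exact ((hd W hW).symm.disjoint_sup_right_of_disjoint_sup_left h1).symm.mono_left
        (by rw [sup_comm])

/-- `C` is a projection whose kernel has dimension `n - k` and misses every `W`. -/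
theorem exists_rank_le_forall_injOn {n : ℕ} (s : Finset (Submodule ℂ (Fin n → ℂ))) {k : ℕ}
    (hk : k ≤ n) (hs : ∀ W ∈ s, Module.finrank ℂ W ≤ k) :
    ∃ C : Matrix (Fin n) (Fin n) ℂ, C.rank ≤ k ∧ ∀ W ∈ s, ∀ x ∈ W, C *ᵥ x = 0 → x = 0 := by
  obtain ⟨U, hU, hd⟩ := exists_submodule_finrank_eq_forall_disjoint s hs (n - k)
    (by rw [Module.finrank_fin_fun]; omega)
  obtain ⟨L, hL⟩ := U.exists_isCompl
  have hker : LinearMap.ker (L.subtype ∘ₗ L.projectionOnto U hL.symm) = U := by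
    rw [LinearMap.ker_comp_of_ker_eq_bot _ L.ker_subtype, Submodule.ker_projectionOnto]
  have hC : (LinearMap.toMatrix' (L.subtype ∘ₗ L.projectionOnto U hL.symm)).mulVecLin =
      L.subtype ∘ₗ L.projectionOnto U hL.symm := by
    rw [← Matrix.toLin'_apply', Matrix.toLin'_toMatrix']
  refine ⟨LinearMap.toMatrix' (L.subtype ∘ₗ L.projectionOnto U hL.symm), ?_, ?_⟩
  · have h := LinearMap.finrank_range_add_finrank_ker
      (L.subtype ∘ₗ L.projectionOnto U hL.symm)
    rw [hker, hU, Module.finrank_fin_fun] at h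
    rw [Matrix.rank, hC]
    omega
  · intro W hW x hx h
    rw [← Matrix.mulVecLin_apply, hC, ← LinearMap.mem_ker, hker] at h
    exact Submodule.disjoint_def.1 (hd W hW) x h hx

/-! ### Spectral projections as polynomials in `A`. -/

/-- Write the characteristic polynomial as `(X - ζ)ᵐ q` with `q(ζ) ≠ 0`. By Cayley–Hamilton `q(A)`
maps into the generalized eigenspace, which is the eigenspace; `f` is `q` normalized at `ζ`. -/
theorem exists_polynomial_eval_eq_one {n : ℕ} {A : Matrix (Fin n) (Fin n) ℂ} {ζ : ℂ}
    (h : algebraicMultiplicity A ζ = geometricMultiplicity A ζ) :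
    ∃ f : Polynomial ℂ, f.eval ζ = 1 ∧ A * Polynomial.aeval A f = ζ • Polynomial.aeval A f := by
  obtain ⟨q, hq, hndvd⟩ := A.charpoly.exists_eq_pow_rootMultiplicity_mul_and_not_dvd
    A.charpoly_monic.ne_zero ζ
  have hq0 : q.eval ζ ≠ 0 := fun h0 => hndvd (Polynomial.dvd_iff_isRoot.2 h0)
  have h0 : (A - ζ • (1 : Matrix (Fin n) (Fin n) ℂ)) ^ A.charpoly.rootMultiplicity ζ *
      Polynomial.aeval A q = 0 := by
    have := congrArg (Polynomial.aeval A) hq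
    rw [Matrix.aeval_self_charpoly, map_mul, map_pow, map_sub, Polynomial.aeval_X,
      Polynomial.aeval_C, Algebra.algebraMap_eq_smul_one] at this
    exact this.symm
  have h1 : A * Polynomial.aeval A q = ζ • Polynomial.aeval A q := by
    refine Matrix.ext_of_mulVec_single fun i => ?_
    rw [← mulVec_mulVec, smul_mulVec]
    refine (algebraicMultiplicity_eq_geometricMultiplicity_iff A ζ).1 h (A.charpoly.rootMultiplicity ζ) _ ?_
    rw [mulVec_mulVec, h0, zero_mulVec]
  refine ⟨Polynomial.C (q.eval ζ)⁻¹ * q, ?_, ?_⟩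
  · rw [Polynomial.eval_mul, Polynomial.eval_C, inv_mul_cancel₀ hq0]
  · rw [map_mul, Polynomial.aeval_C, Algebra.algebraMap_eq_smul_one, smul_mul_assoc, one_mul,
      mul_smul_comm, h1, smul_comm]

theorem aeval_mulVec_of_eigenvector {n : ℕ} {A : Matrix (Fin n) (Fin n) ℂ} {μ : ℂ}
    {x : Fin n → ℂ} (h : A *ᵥ x = μ • x) (f : Polynomial ℂ) :
    Polynomial.aeval A f *ᵥ x = f.eval μ • x := by
  induction f using Polynomial.induction_on' with
  | add p q hp hq => rw [map_add, add_mulVec, hp, hq, Polynomial.eval_add, add_smul]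
  | monomial k a =>
    rw [Polynomial.aeval_monomial, Polynomial.eval_monomial, Algebra.algebraMap_eq_smul_one,
      smul_mul_assoc, one_mul, smul_mulVec, mul_smul]
    congr 1
    induction k with
    | zero => simp
    | succ k ih => rw [pow_succ', ← mulVec_mulVec, ih, mulVec_smul, h, smul_smul, pow_succ]

/-! ### Reduction to the Stein equation, and its solution by a series. -/

/-- With `G = S*S`, `V = SAS⁻¹` and `R = QS⁻¹`, the equation reads `V*V = 1 - R*R`. So `ker V` lies
in the range of `R*`, and the rank bound forces equality. Hence `VR* = 0` and `VV*V = V - VR*R = V`.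
-/
theorem exists_isPartialIsometry_isSimilar_of_posDef {n : ℕ} {A G Q : Matrix (Fin n) (Fin n) ℂ}
    (hG : G.PosDef) (hQ : Q.rank ≤ nullity A) (h : G = Aᴴ * G * A + Qᴴ * Q) :
    ∃ V : Matrix (Fin n) (Fin n) ℂ, IsPartialIsometry V ∧ IsSimilar A V := by
  obtain ⟨S, rfl⟩ : ∃ S : Matrix (Fin n) (Fin n) ℂ, G = Sᴴ * S :=
    CStarAlgebra.nonneg_iff_eq_star_mul_self.1 hG.posSemidef.nonneg
  have hS : IsUnit S.det := by
    have := (Matrix.isUnit_iff_isUnit_det _).1 hG.isUnit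
    rw [det_mul] at this
    exact isUnit_of_mul_isUnit_right this
  have hSi : IsUnit S⁻¹.det := Matrix.isUnit_nonsing_inv_det _ hS
  set V := S * A * S⁻¹ with hVdef
  set R := Q * S⁻¹ with hR
  have hV : Vᴴ * V = 1 - Rᴴ * R := by
    have h1 : Rᴴ * R + Vᴴ * V = 1 := by
      have : Rᴴ * R + Vᴴ * V = (S⁻¹)ᴴ * (Aᴴ * (Sᴴ * S) * A + Qᴴ * Q) * S⁻¹ := by
        simp only [hVdef, hR, conjTranspose_mul]
        noncomm_ring
      rw [this, ← h, ← Matrix.mul_assoc, ← conjTranspose_mul, mul_nonsing_inv _ hS,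
        conjTranspose_one, one_mul, mul_nonsing_inv _ hS]
    rw [← h1, add_sub_cancel_left]
  have hrank : Rᴴ.rank ≤ nullity V := by
    rw [rank_conjTranspose, hR, rank_mul_eq_left_of_isUnit_det _ _ hSi, hVdef,
      nullity_conj ((Matrix.isUnit_iff_isUnit_det _).2 hS)]
    exact hQ
  have hle : LinearMap.ker V.mulVecLin ≤ LinearMap.range Rᴴ.mulVecLin := by
    intro x hx
    rw [LinearMap.mem_ker, mulVecLin_apply] at hx
    refine ⟨R *ᵥ x, ?_⟩
    have := congrArg (· *ᵥ x) hV
    simp only [← mulVec_mulVec, hx, mulVec_zero, sub_mulVec, one_mulVec] at this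
    rw [mulVecLin_apply]
    exact (sub_eq_zero.1 this.symm).symm
  have heq := Submodule.eq_of_le_of_finrank_le hle hrank
  have hVR : V * Rᴴ = 0 := by
    refine Matrix.ext_of_mulVec_single fun i => ?_
    rw [← mulVec_mulVec, zero_mulVec, ← mulVecLin_apply V, ← LinearMap.mem_ker, heq]
    exact ⟨_, rfl⟩
  refine ⟨V, ?_, S⁻¹, (Matrix.isUnit_iff_isUnit_det _).2 hSi, ?_⟩
  · rw [IsPartialIsometry, Matrix.mul_assoc, hV, mul_sub, mul_one, ← Matrix.mul_assoc, hVR,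
      Matrix.zero_mul, sub_zero]
  · rw [nonsing_inv_nonsing_inv _ hS, hVdef, Matrix.mul_assoc S,
      nonsing_inv_mul_cancel_left _ _ hS, nonsing_inv_mul_cancel_right _ _ hS]

/-- Gelfand's formula gives `‖aⁿ‖ ≤ rⁿ` eventually, for some `r < 1`. -/
theorem summable_norm_pow_of_spectrum_subset {E : Type*} [NormedRing E] [NormedAlgebra ℂ E]
    [CompleteSpace E] {a : E} (ha : spectrum ℂ a ⊆ Metric.ball (0 : ℂ) 1) :
    Summable fun n : ℕ => ‖a ^ n‖ := by
  have h1 : spectralRadius ℂ a < (1 : NNReal) := by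
    -- The spectrum is empty in the zero ring, as for matrices of size 0.
    rcases (spectrum ℂ a).eq_empty_or_nonempty with h | h
    · simp [spectralRadius, h]
    · exact spectrum.spectralRadius_lt_of_forall_lt_of_nonempty h fun k hk => by
        exact_mod_cast mem_ball_zero_iff.1 (ha hk)
  obtain ⟨r, hr1, hr2⟩ := ENNReal.lt_iff_exists_nnreal_btwn.1 h1
  have h2 := (spectrum.pow_nnnorm_pow_one_div_tendsto_nhds_spectralRadius a).eventually_lt_const
    hr1
  have hr : (r : ℝ) < 1 := by exact_mod_cast hr2
  refine Summable.of_norm_bounded_eventually_nat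
    (summable_geometric_of_lt_one r.coe_nonneg hr) ?_
  filter_upwards [h2, Filter.eventually_gt_atTop 0] with n hn hn0
  rw [norm_norm]
  have h3 : (‖a ^ n‖₊ : ENNReal) ≤ (r : ENNReal) ^ n := by
    have := ENNReal.rpow_le_rpow hn.le (Nat.cast_nonneg n : (0 : ℝ) ≤ n)
    rwa [← ENNReal.rpow_mul, one_div, inv_mul_cancel₀ (by positivity), ENNReal.rpow_one,
      ENNReal.rpow_natCast] at this
  exact_mod_cast h3

section

open scoped Matrix.Norms.L2Operator

/-- Conjugating `∑ (CPAᵏ)* (CPAᵏ)` by `A` shifts the index and drops only the term `k = 0`. The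
series converges because `PAᵏ = P(AP)ᵏ`. -/
theorem exists_posSemidef_eq_conj_add {n : ℕ} {A P : Matrix (Fin n) (Fin n) ℂ}
    (hP : IsIdempotentElem P) (hAP : Commute A P)
    (hs : spectrum ℂ (A * P) ⊆ Metric.ball (0 : ℂ) 1) (C : Matrix (Fin n) (Fin n) ℂ) :
    ∃ G : Matrix (Fin n) (Fin n) ℂ, G.PosSemidef ∧
      G = Aᴴ * G * A + (C * P)ᴴ * (C * P) := by
  have hsum := summable_norm_pow_of_spectrum_subset hs
  have hpow : ∀ k : ℕ, P * A ^ k = P * (A * P) ^ k := by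
    intro k
    rw [hAP.mul_pow, ← Matrix.mul_assoc, (hAP.pow_left k).symm.eq, Matrix.mul_assoc,
      ← pow_succ', hP.pow_succ_eq]
  have hS : Summable fun k : ℕ => (C * P * A ^ k)ᴴ * (C * P * A ^ k) := by
    obtain ⟨b, hb⟩ := hsum.tendsto_atTop_zero.bddAbove_range
    refine Summable.of_norm_bounded (hsum.mul_left (‖C * P‖ * ‖C * P‖ * b)) fun k => ?_
    have h1 : ‖C * P * A ^ k‖ ≤ ‖C * P‖ * ‖(A * P) ^ k‖ := by
      rw [Matrix.mul_assoc, hpow, ← Matrix.mul_assoc]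
      exact norm_mul_le _ _
    have h2 : ‖(A * P) ^ k‖ ≤ b := hb ⟨k, rfl⟩
    rw [← star_eq_conjTranspose, CStarRing.norm_star_mul_self]
    calc ‖C * P * A ^ k‖ * ‖C * P * A ^ k‖
        ≤ (‖C * P‖ * ‖(A * P) ^ k‖) * (‖C * P‖ * ‖(A * P) ^ k‖) := by gcongr
      _ = ‖C * P‖ * ‖C * P‖ * ‖(A * P) ^ k‖ * ‖(A * P) ^ k‖ := by ring
      _ ≤ ‖C * P‖ * ‖C * P‖ * b * ‖(A * P) ^ k‖ := by gcongr
  refine ⟨∑' k : ℕ, (C * P * A ^ k)ᴴ * (C * P * A ^ k), ?_, ?_⟩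
  · rw [← nonneg_iff_posSemidef]
    exact tsum_nonneg fun k => (posSemidef_conjTranspose_mul_self _).nonneg
  · have h1 : Aᴴ * (∑' k : ℕ, (C * P * A ^ k)ᴴ * (C * P * A ^ k)) * A =
        ∑' k : ℕ, (C * P * A ^ (k + 1))ᴴ * (C * P * A ^ (k + 1)) := by
      rw [← hS.tsum_mul_left, ← (hS.mul_left _).tsum_mul_right]
      refine tsum_congr fun k => ?_
      simp only [pow_succ, conjTranspose_mul, Matrix.mul_assoc]
    rw [h1, add_comm, hS.tsum_eq_zero_add, pow_zero, mul_one]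

end

/-! ### Kernels of semidefinite sums, invariant subspaces and idempotents. -/

theorem Matrix.PosSemidef.add_mulVec_eq_zero {ι : Type*} [Fintype ι] [DecidableEq ι]
    {M N : Matrix ι ι ℂ} (hM : M.PosSemidef) (hN : N.PosSemidef) {x : ι → ℂ}
    (h : (M + N) *ᵥ x = 0) : M *ᵥ x = 0 ∧ N *ᵥ x = 0 := by
  have h1 := congrArg (star x ⬝ᵥ ·) h
  simp only [add_mulVec, dotProduct_add, dotProduct_zero] at h1
  rwa [add_eq_zero_iff_of_nonneg (hM.dotProduct_mulVec_nonneg x)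
    (hN.dotProduct_mulVec_nonneg x), hM.dotProduct_mulVec_zero_iff,
    hN.dotProduct_mulVec_zero_iff] at h1

theorem Matrix.PosSemidef.mulVec_mulVec_eq_zero_of_conj {m n : Type*} [Fintype m] [Fintype n]
    [DecidableEq m] {M : Matrix m m ℂ} (hM : M.PosSemidef) {B : Matrix m n ℂ} {x : n → ℂ}
    (h : (Bᴴ * M * B) *ᵥ x = 0) : M *ᵥ (B *ᵥ x) = 0 := by
  rw [← hM.dotProduct_mulVec_zero_iff, star_mulVec, ← dotProduct_mulVec, mulVec_mulVec,
    mulVec_mulVec, h, dotProduct_zero]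

theorem Matrix.mulVec_eq_zero_of_sum_conjTranspose_mul_self {m n ι : Type*} [Fintype m]
    [Fintype n] [DecidableEq n] {s : Finset ι} {E : ι → Matrix m n ℂ} {x : n → ℂ}
    (h : (∑ i ∈ s, (E i)ᴴ * E i) *ᵥ x = 0) : ∀ i ∈ s, E i *ᵥ x = 0 := by
  classical
  intro i hi
  rw [← Finset.add_sum_erase s _ hi] at h
  have h1 := ((posSemidef_conjTranspose_mul_self (E i)).add_mulVec_eq_zero
    (posSemidef_sum _ fun j _ => posSemidef_conjTranspose_mul_self (E j)) h).1
  rw [← mulVecLin_apply, ← LinearMap.mem_ker, ker_mulVecLin_conjTranspose_mul_self] at h1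
  exact h1

theorem Module.End.exists_eigenvector_mem {K E : Type*} [Field K] [IsAlgClosed K]
    [AddCommGroup E] [Module K E] [FiniteDimensional K E] (T : Module.End K E)
    {N : Submodule K E} (hN : N ≠ ⊥) (hT : ∀ x ∈ N, T x ∈ N) :
    ∃ μ : K, ∃ x ∈ N, x ≠ 0 ∧ T x = μ • x := by
  have : Nontrivial N := Submodule.nontrivial_iff_ne_bot.2 hN
  obtain ⟨μ, hμ⟩ := Module.End.exists_eigenvalue (LinearMap.restrict T hT)
  obtain ⟨x, hx⟩ := hμ.exists_hasEigenvector
  refine ⟨μ, x, x.2, fun h => hx.2 (Subtype.ext h), ?_⟩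
  simpa using congrArg Subtype.val hx.apply_eq_smul

theorem IsIdempotentElem.one_sub_sum {ι R : Type*} [Ring R] [DecidableEq ι] (s : Finset ι)
    {e : ι → R} (he : ∀ i ∈ s, ∀ j ∈ s, e i * e j = if i = j then e i else 0) :
    IsIdempotentElem (1 - ∑ i ∈ s, e i) := by
  refine IsIdempotentElem.one_sub ?_
  rw [IsIdempotentElem, Finset.sum_mul_sum]
  refine Finset.sum_congr rfl fun i hi => ?_
  rw [Finset.sum_congr rfl (he i hi), Finset.sum_ite_eq, if_pos hi]

/-! ### Sufficiency: construction of the definite form. -/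

theorem exists_isPartialIsometry_isSimilar_of_conditions {n : ℕ} {A : Matrix (Fin n) (Fin n) ℂ}
    (ha : spectrum ℂ A ⊆ Metric.closedBall (0 : ℂ) 1)
    (hb : ∀ ζ ∈ spectrum ℂ A ∩ Metric.sphere (0 : ℂ) 1,
      algebraicMultiplicity A ζ = geometricMultiplicity A ζ)
    (hc : ∀ μ ∈ spectrum ℂ A ∩ Metric.ball (0 : ℂ) 1,
      nullity A ≥ nullity (A - μ • (1 : Matrix (Fin n) (Fin n) ℂ))) :
    ∃ V : Matrix (Fin n) (Fin n) ℂ, IsPartialIsometry V ∧ IsSimilar A V := by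
  classical
  have hfin : (spectrum ℂ A).Finite := Matrix.finite_spectrum A
  set U : Finset ℂ := (hfin.inter_of_left (Metric.sphere (0 : ℂ) 1)).toFinset with hU
  have hUmem : ∀ ζ, ζ ∈ U ↔ ζ ∈ spectrum ℂ A ∩ Metric.sphere (0 : ℂ) 1 := fun ζ => by
    rw [hU, Set.Finite.mem_toFinset]
  have hUnorm : ∀ ζ ∈ U, ‖ζ‖ = 1 := fun ζ hζ => mem_sphere_zero_iff_norm.1 ((hUmem ζ).1 hζ).2
  choose! f hf1 hf2 using fun ζ (hζ : ζ ∈ U) =>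
    exists_polynomial_eval_eq_one (hb ζ ((hUmem ζ).1 hζ))
  set E : ℂ → Matrix (Fin n) (Fin n) ℂ := fun ζ => Polynomial.aeval A (f ζ) with hE
  have hcomm : ∀ ζ, Commute A (E ζ) := fun ζ => by
    simpa [hE] using (Polynomial.commute_X (f ζ)).map (Polynomial.aeval A)
  have hfix : ∀ ζ ∈ U, ∀ x, A *ᵥ x = ζ • x → E ζ *ᵥ x = x := fun ζ hζ x hx => by
    rw [hE, aeval_mulVec_of_eigenvector hx, hf1 ζ hζ, one_smul]
  have hker : ∀ ζ ∈ U, ∀ μ, μ ≠ ζ → ∀ x, A *ᵥ x = μ • x → E ζ *ᵥ x = 0 := by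
    intro ζ hζ μ hμ x hx
    have h1 := congrArg (· *ᵥ x) (hf2 ζ hζ)
    simp only [← mulVec_mulVec, smul_mulVec] at h1
    rw [aeval_mulVec_of_eigenvector hx, mulVec_smul, hx, smul_comm, ← sub_eq_zero, ← sub_smul,
      smul_eq_zero, or_iff_right (sub_ne_zero.2 hμ)] at h1
    rw [hE, aeval_mulVec_of_eigenvector hx, h1]
  have hEx : ∀ ζ ∈ U, ∀ x, A *ᵥ (E ζ *ᵥ x) = ζ • (E ζ *ᵥ x) := fun ζ hζ x => by
    rw [mulVec_mulVec, hf2 ζ hζ, smul_mulVec]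
  have horth : ∀ ζ ∈ U, ∀ η ∈ U, E ζ * E η = if ζ = η then E ζ else 0 := by
    intro ζ hζ η hη
    refine Matrix.ext_of_mulVec_single fun i => ?_
    rw [← mulVec_mulVec]
    split_ifs with h
    · subst h
      exact hfix ζ hζ _ (hEx ζ hζ _)
    · rw [hker ζ hζ η (Ne.symm h) _ (hEx η hη _), zero_mulVec]
  set P : Matrix (Fin n) (Fin n) ℂ := 1 - ∑ ζ ∈ U, E ζ with hPdef
  have hP : IsIdempotentElem P := IsIdempotentElem.one_sub_sum U horth
  have hAP : Commute A P :=
    (Commute.one_right A).sub_right (Commute.sum_right _ _ _ fun ζ _ => hcomm ζ)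
  have hPx : ∀ x, (∀ ζ ∈ U, E ζ *ᵥ x = 0) → P *ᵥ x = x := fun x hx => by
    rw [hPdef, sub_mulVec, one_mulVec, sum_mulVec, Finset.sum_eq_zero hx, sub_zero]
  have hEP : ∀ ζ ∈ U, E ζ * P = 0 := fun ζ hζ => by
    rw [hPdef, mul_sub, mul_one, Finset.mul_sum, Finset.sum_congr rfl (horth ζ hζ),
      Finset.sum_ite_eq, if_pos hζ, sub_self]
  have hdisc : ∀ μ ∈ spectrum ℂ A, μ ∉ U → ‖μ‖ < 1 := fun μ hμ hμU =>
    lt_of_le_of_ne (mem_closedBall_zero_iff.1 (ha hμ)) fun h =>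
      hμU ((hUmem μ).2 ⟨hμ, mem_sphere_zero_iff_norm.2 h⟩)
  have hspec : spectrum ℂ (A * P) ⊆ Metric.ball (0 : ℂ) 1 := by
    intro μ hμ
    obtain ⟨x, hx, h⟩ := mem_spectrum_iff_exists_mulVec.1 hμ
    rw [mem_ball_zero_iff]
    rcases eq_or_ne μ 0 with rfl | hμ0
    · simp
    -- For `μ ≠ 0` an eigenvector of `AP` lies in the range of `P`, where `AP` acts as `A`.
    have hPxx : P *ᵥ x = x := by
      have h1 : P *ᵥ (μ • x) = μ • x := by
        rw [← h, mulVec_mulVec, ← Matrix.mul_assoc, ← hAP.eq, Matrix.mul_assoc, hP.eq]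
      rw [mulVec_smul] at h1
      exact smul_right_injective _ hμ0 h1
    rw [← mulVec_mulVec, hPxx] at h
    refine hdisc μ (mem_spectrum_iff_exists_mulVec.2 ⟨x, hx, h⟩) fun hμU => hx ?_
    rw [← hfix μ hμU x h, ← hPxx, mulVec_mulVec, hEP μ hμU, zero_mulVec]
  obtain ⟨C, hCrank, hC⟩ := exists_rank_le_forall_injOn (k := nullity A)
    ((hfin.inter_of_left (Metric.ball (0 : ℂ) 1)).toFinset.image fun μ =>
      LinearMap.ker (A - μ • (1 : Matrix (Fin n) (Fin n) ℂ)).mulVecLin)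
    (by have := nullity_add_rank A; omega)
    (by
      intro W hW
      obtain ⟨μ, hμ, rfl⟩ := Finset.mem_image.1 hW
      exact hc μ ((Set.Finite.mem_toFinset _).1 hμ))
  obtain ⟨G, hG, hGeq⟩ := exists_posSemidef_eq_conj_add hP hAP hspec C
  set H : Matrix (Fin n) (Fin n) ℂ := ∑ ζ ∈ U, (E ζ)ᴴ * E ζ with hH
  have hHpsd : H.PosSemidef := posSemidef_sum U fun ζ _ => posSemidef_conjTranspose_mul_self _
  -- Each term is preserved because `E ζ * A = ζ • E ζ` with `|ζ| = 1`.
  have hHeq : Aᴴ * H * A = H := by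
    rw [hH, Finset.mul_sum, Finset.sum_mul]
    refine Finset.sum_congr rfl fun ζ hζ => ?_
    have h1 : E ζ * A = ζ • E ζ := (hcomm ζ).eq.symm.trans (hf2 ζ hζ)
    rw [← Matrix.mul_assoc, ← conjTranspose_mul, Matrix.mul_assoc, h1, conjTranspose_smul,
      smul_mul_smul_comm, Complex.star_def, Complex.conj_mul', hUnorm ζ hζ]
    simp
  have hsum : H + G = Aᴴ * (H + G) * A + (C * P)ᴴ * (C * P) := by
    rw [mul_add, add_mul, hHeq, add_assoc, ← hGeq]
  refine exists_isPartialIsometry_isSimilar_of_posDef (G := H + G) (Q := C * P) ?_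
    ((rank_mul_le_left C P).trans hCrank) hsum
  have hpsd := hHpsd.add hG
  -- Both terms on the right of `hsum` are semidefinite, so a null vector of the sum is null for
  -- each; the first makes the kernel `A`-invariant.
  have hinv : ∀ x, (H + G) *ᵥ x = 0 → (H + G) *ᵥ (A *ᵥ x) = 0 ∧ (C * P) *ᵥ x = 0 := by
    intro x hx
    rw [hsum] at hx
    obtain ⟨h1, h2⟩ := (hpsd.conjTranspose_mul_mul_same A).add_mulVec_eq_zero
      (posSemidef_conjTranspose_mul_self _) hx
    refine ⟨hpsd.mulVec_mulVec_eq_zero_of_conj h1, ?_⟩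
    rwa [← mulVecLin_apply, ← LinearMap.mem_ker, ker_mulVecLin_conjTranspose_mul_self] at h2
  rw [hpsd.posDef_iff_isUnit, ← mulVec_injective_iff_isUnit]
  change Function.Injective (H + G).mulVecLin
  rw [← LinearMap.ker_eq_bot]
  by_contra hne
  obtain ⟨μ, x, hx, hx0, hμx⟩ := Module.End.exists_eigenvector_mem (Matrix.mulVecLin A) hne
    fun x hx => (hinv x hx).1
  rw [mulVecLin_apply] at hμx
  have hμ : μ ∈ spectrum ℂ A := mem_spectrum_iff_exists_mulVec.2 ⟨x, hx0, hμx⟩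
  have hE0 : ∀ ζ ∈ U, E ζ *ᵥ x = 0 :=
    mulVec_eq_zero_of_sum_conjTranspose_mul_self (hHpsd.add_mulVec_eq_zero hG hx).1
  by_cases hμU : μ ∈ U
  -- An eigenvector in the kernel is killed by every `E ζ`, but `E μ` fixes it if `μ` is unimodular.
  -- Otherwise `P` fixes it, so `C` kills it, against injectivity on the eigenspace.
  · exact hx0 ((hfix μ hμU x hμx).symm.trans (hE0 μ hμU))
  · have hCx : C *ᵥ x = 0 := by
      rw [← hPx x hE0, mulVec_mulVec]
      exact (hinv x hx).2
    refine hx0 (hC _ (Finset.mem_image.2 ⟨μ, ?_, rfl⟩) x (mem_ker_sub_smul_one.2 hμx) hCx)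
    rw [Set.Finite.mem_toFinset]
    exact ⟨hμ, mem_ball_zero_iff.2 (hdisc μ hμ hμU)⟩

theorem mainTheorem1 (n : ℕ) (A : Matrix (Fin n) (Fin n) ℂ) :
    (∃ V : Matrix (Fin n) (Fin n) ℂ, IsPartialIsometry V ∧ IsSimilar A V) ↔
      (spectrum ℂ A ⊆ Metric.closedBall (0 : ℂ) 1) ∧
      (∀ ζ ∈ spectrum ℂ A ∩ Metric.sphere (0 : ℂ) 1,
        algebraicMultiplicity A ζ = geometricMultiplicity A ζ) ∧
      (∀ μ ∈ spectrum ℂ A ∩ Metric.ball (0 : ℂ) 1,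
        nullity A ≥ nullity (A - μ • (1 : Matrix (Fin n) (Fin n) ℂ))) :=
  ⟨fun ⟨_, hV, hAV⟩ => conditions_of_isSimilar_isPartialIsometry hV hAV,
    fun ⟨ha, hb, hc⟩ => exists_isPartialIsometry_isSimilar_of_conditions ha hb hc⟩
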